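/- Let $p$ be a prime, $f\ge 1$, $q=p^f$ and $m\ge 2$. Let $V$ be a vector space of dimension $2m$ over the field $\mathbb F_{q^2}$, equipped with a non-degenerate unitary form $\beta$ (that is, $\beta$ is sesquilinear and $\beta(y,x)=\beta(x,y)^q$), and let $e_1,\dots,e_m,f_1,\dots,f_m$ be a basis of $V$ with $\beta(e_i,e_j)=\beta(f_i,f_j)=0$ and $\beta(e_i,f_j)=\delta_{ij}$ for all $i,j$. Put $E=\langle e_1,\dots,e_m\rangle$ and $E'=\langle f_1,\dots,f_m\rangle$. Let $G=\mathrm{GU}(V,\beta)=\mathrm{GU}_{2m}(q)$ be the isometry group of $\beta$, let $A=\mathrm P_m[G]$ be the stabilizer of $E$ in $G$, let $R=\mathbf O_p(A)$ be the largest normal $p$-subgroup of $A$, and let $C\cong\mathrm{GL}_m(q^2)$ be the stabilizer of $E'$ in $A$, identified with $\mathrm{GL}(E)$ by restriction to $E$. Let $S$ be a Singer cycle of $C$: the subgroup of $C$ corresponding to the group of multiplications by nonzero elements of $\mathbb F_{q^{2m}}$ under some $\mathbb F_{q^2}$-linear identification of $E$ with $\mathbb F_{q^{2m}}$. Put $H=RS$.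 Finally let $v\in V$ be any nonisotropic vector, i.e. $\beta(v,v)\ne 0$ (for example $v=e_m+\mu f_m$ with $\mu\in\mathbb F_{q^2}$, $\mu+\mu^q\neq0$), and let $K$ be the stabilizer of $v$ in $G$. Then: 1. $H\le A$, $H$ is solvable, and $H=R{:}S=q^{m^2}{:}\mathrm{GL}_1(q^{2m})$; that is, $R$ is normal in $H$, $H=RS$ with $R\cap S=1$, $R$ is an elementary abelian $p$-group of order $q^{m^2}$, and $S\cong\mathrm{GL}_1(q^{2m})$. 2. $H\cap K=R\cap K$, and this is an elementary abelian $p$-group of order $q^{(m-1)^2}$. 3. $K=\mathrm{GU}_{2m-1}(q)$; that is, $v^\perp$ has dimension $2m-1$, the restriction of $\beta$ to $v^\perp$ is non-degenerate, and restriction to $v^\perp$ is an isomorphism from $K$ onto the isometry group of $\beta|_{v^\perp}$. 4. $\mathrm{GU}_{2m}(q)=G=HK$. -/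

import Mathlib

open scoped Pointwise

universe u w

/-- The isometry group of a sesquilinear form `β` on `V`, as a subgroup of `GL(V)`.  For a
non-degenerate hermitian form on an `n`-dimensional space over the field of order `q ^ 2`
(hermitian with respect to `x ↦ x ^ q`) this is the general unitary group `GU_n(q)`. -/
def unitaryIsometryGroup {F V : Type*} [Field F] [AddCommGroup V] [Module F V] {σ : F →+* F}
    (β : V →ₛₗ[σ] V →ₗ[F] F) : Subgroup (V ≃ₗ[F] V) where
  carrier := {g | ∀ x y, β (g x) (g y) = β x y}
  one_mem' := fun _ _ => rfl
  mul_mem' := fun {a b} ha hb x y => by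
    change β (a (b x)) (a (b y)) = β x y
    rw [ha, hb]
  inv_mem' := fun {a} ha x y => by
    change β (a.symm x) (a.symm y) = β x y
    rw [← ha, LinearEquiv.apply_symm_apply, LinearEquiv.apply_symm_apply]

/-- The stabilizer in `GL(V)` of a subspace `U`, i.e. the group of all `g` with `g U = U`. -/
def subspaceStabilizer {F V : Type*} [Field F] [AddCommGroup V] [Module F V]
    (U : Submodule F V) : Subgroup (V ≃ₗ[F] V) where
  carrier := {g | U.map (g : V →ₗ[F] V) = U}
  one_mem' := by
    change U.map LinearMap.id = U
    exact Submodule.map_id U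
  mul_mem' := fun {a b} ha hb => by
    change U.map ((a : V →ₗ[F] V).comp (b : V →ₗ[F] V)) = U
    rw [Submodule.map_comp, show U.map (b : V →ₗ[F] V) = U from hb]
    exact ha
  inv_mem' := fun {a} ha => by
    change U.map (a.symm : V →ₗ[F] V) = U
    conv_lhs => rw [← show U.map (a : V →ₗ[F] V) = U from ha]
    rw [← Submodule.map_comp]
    simp

/-- The stabilizer in `GL(V)` of a vector `v`. -/
def vectorStabilizer {F V : Type*} [Field F] [AddCommGroup V] [Module F V]
    (v : V) : Subgroup (V ≃ₗ[F] V) where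
  carrier := {g | g v = v}
  one_mem' := rfl
  mul_mem' := fun {a b} ha hb => by
    change a (b v) = v
    rw [show b v = v from hb, show a v = v from ha]
  inv_mem' := fun {a} ha => by
    change a.symm v = v
    rw [LinearEquiv.symm_apply_eq]
    exact (show a v = v from ha).symm

/-- `O_p(Γ)`: the subgroup generated by all normal `p`-subgroups of `Γ`.  For a finite group
this is the largest normal `p`-subgroup. -/
def pCore (p : ℕ) (Γ : Type*) [Group Γ] : Subgroup Γ :=
  sSup {N : Subgroup Γ | N.Normal ∧ IsPGroup p N}

/-- `T ≤ GL(U)` is a Singer cycle: for some field extension `L / F` and some `F`-linear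
identification of `U` with `L`, the group `T` consists of the multiplications by the nonzero
elements of `L`, i.e. `T` is the group `GL_1(L)` of all `L`-linear bijections of `L`, viewed
inside `GL(U)`.  Varying the identification gives all conjugates. -/
def IsSingerCycle {F : Type u} {U : Type w} [Field F] [AddCommGroup U] [Module F U]
    (T : Subgroup (U ≃ₗ[F] U)) : Prop :=
  ∃ (L : Type w) (_ : Field L) (_ : Algebra F L) (φ : U ≃ₗ[F] L),
    ∀ g : U ≃ₗ[F] U, g ∈ T ↔ ∃ a : Lˣ, ∀ x : U, φ (g x) = (a : L) * φ x

/-- The elements of a group `C ≤ GL(V)` which leave `U` invariant and whose restriction to `U`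
lies in `T ≤ GL(U)`; that is, the preimage of `T` under the restriction map. -/
def restrictPreimage {F V : Type*} [Field F] [AddCommGroup V] [Module F V]
    (C : Subgroup (V ≃ₗ[F] V)) (U : Submodule F V) (T : Subgroup (U ≃ₗ[F] U)) :
    Subgroup (V ≃ₗ[F] V) where
  carrier := {g | g ∈ C ∧ ∃ t ∈ T, ∀ x : U, ((t x : U) : V) = g (x : V)}
  one_mem' := ⟨C.one_mem, 1, T.one_mem, fun _ => rfl⟩
  mul_mem' := fun {a b} ⟨ha, s, hs, hsa⟩ ⟨hb, t, ht, htb⟩ =>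
    ⟨C.mul_mem ha hb, s * t, T.mul_mem hs ht, fun x => by
      change ((s (t x) : U) : V) = a (b x)
      rw [hsa, htb]⟩
  inv_mem' := fun {a} ⟨ha, s, hs, hsa⟩ =>
    ⟨C.inv_mem ha, s⁻¹, T.inv_mem hs, fun x => by
      change ((s.symm x : U) : V) = a.symm x
      rw [LinearEquiv.eq_symm_apply, ← hsa, LinearEquiv.apply_symm_apply]⟩

/-- `Γ` is an elementary abelian `p`-group. -/
def IsElementaryAbelian (p : ℕ) (Γ : Type*) [Group Γ] : Prop :=
  (∀ x y : Γ, x * y = y * x) ∧ ∀ x : Γ, x ^ p = 1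

/-- The parabolic subgroup: the stabilizer in the isometry group of `β` of a (totally singular)
subspace `E`. -/
def parabolicSubgroup {F V : Type*} [Field F] [AddCommGroup V] [Module F V] {σ : F →+* F}
    (β : V →ₛₗ[σ] V →ₗ[F] F) (E : Submodule F V) : Subgroup (V ≃ₗ[F] V) :=
  unitaryIsometryGroup β ⊓ subspaceStabilizer E

/-- `O_p` of the parabolic subgroup, as a subgroup of `GL(V)`. -/
def parabolicCore {F V : Type*} [Field F] [AddCommGroup V] [Module F V] {σ : F →+* F}
    (p : ℕ) (β : V →ₛₗ[σ] V →ₗ[F] F) (E : Submodule F V) : Subgroup (V ≃ₗ[F] V) :=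
  (pCore p (parabolicSubgroup β E)).map (parabolicSubgroup β E).subtype

/-- The Levi factor of the parabolic subgroup given by a decomposition `V = E ⊕ E'` into totally
singular subspaces: the isometries leaving both `E` and `E'` invariant. -/
def leviFactor {F V : Type*} [Field F] [AddCommGroup V] [Module F V] {σ : F →+* F}
    (β : V →ₛₗ[σ] V →ₗ[F] F) (E E' : Submodule F V) : Subgroup (V ≃ₗ[F] V) :=
  parabolicSubgroup β E ⊓ subspaceStabilizer E'

/-!
The structure of `A`, the stabilizer of the Lagrangian subspace `E`, comes from its action on `E`.
The kernel of this action, `unipotentRadical β E`, consists of the isometries `1 + N` with `N`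
vanishing on `E` and taking values in `E` (as `E = E^⊥`), so it is elementary abelian, and in an
adapted basis it becomes the group of skew-hermitian `m × m` matrices, of order `q ^ (m ^ 2)`
(`IsWittBasis.card_unipotentRadical_sq`).  Every element of `GL(E)` extends to the Levi factor
(`IsWittBasis.exists_mem_leviFactor`), so `A` is transitive on `E \ {0}`; a normal `p`-subgroup of
`A` fixes a nonzero vector of `E`, hence all of `E`.  Therefore `O_p(A)` is the unipotent radical
(`IsLagrangian.parabolicCore_eq`), and `H = RS` is the preimage in `A` of the Singer cycle `T`.

Let `v` be nonisotropic.  If `h ∈ H` fixes `v` and acts on `E` as `t ≠ 1`, then `t - 1` is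
surjective on `E`, since `T ∪ {0}` is a field; as `β (h x - x) v = 0` for `x ∈ E`, this puts `v`
into `E^⊥ = E`, which is absurd.  So `H ∩ K = R ∩ K`
(`mem_unipotentRadical_of_apply_eq`).

For the factorization it is enough that `H` is transitive on the vectors `u` with `β u u = β v v`,
a set that `G` preserves.  Modulo `E = E^⊥`, a vector `v` is determined by the functional `β v` on
`E`, and `T` is transitive on nonzero functionals (`IsSingerCycle.exists_functional_apply_eq`).
Inside the coset `v + E` the unipotent radical is transitive on the vectors of norm `β v v`, by an
explicit skew map (`IsLagrangian.exists_unipotentRadical_apply_eq`).  The same fact gives the order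
of `R ∩ K`: the orbit of `v` under `R` has `q ^ (2 * m - 1)` elements.

Finally `V = ⟨v⟩ ⊕ v^⊥`, so that the isometries fixing `v` are the isometries of `v^⊥`
(`exists_mulEquiv_isometryGroup_ker`).
-/

/-! ### Lagrangian subspaces and their unipotent radicals -/

section Lagrangian

variable {F V : Type*} [Field F] [AddCommGroup V] [Module F V] {σ : F →+* F}
  {β : V →ₛₗ[σ] V →ₗ[F] F} {E : Submodule F V}

/-- `E` is a Lagrangian subspace for `β`, i.e. it equals its own (right) orthogonal complement. -/
def IsLagrangian (β : V →ₛₗ[σ] V →ₗ[F] F) (E : Submodule F V) : Prop :=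
  ∀ y, y ∈ E ↔ ∀ x ∈ E, β x y = 0

/-- The isometries of `β` which fix the subspace `E` pointwise.  If `E` is Lagrangian they also
act trivially on `V / E`, and they form the unipotent radical of the stabilizer of `E`. -/
def unipotentRadical (β : V →ₛₗ[σ] V →ₗ[F] F) (E : Submodule F V) : Subgroup (V ≃ₗ[F] V) where
  carrier := {g | g ∈ unitaryIsometryGroup β ∧ ∀ x ∈ E, g x = x}
  one_mem' := ⟨one_mem _, fun _ _ => rfl⟩
  mul_mem' := fun {a b} ha hb => ⟨mul_mem ha.1 hb.1, fun x hx => by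
    change a (b x) = x
    rw [hb.2 x hx, ha.2 x hx]⟩
  inv_mem' := fun {a} ha => ⟨inv_mem ha.1, fun x hx => by
    change a.symm x = x
    rw [LinearEquiv.symm_apply_eq, ha.2 x hx]⟩

theorem mem_subspaceStabilizer {g : V ≃ₗ[F] V} :
    g ∈ subspaceStabilizer E ↔ E.map (g : V →ₗ[F] V) = E := Iff.rfl

theorem apply_mem_of_mem_subspaceStabilizer {g : V ≃ₗ[F] V} (hg : g ∈ subspaceStabilizer E)
    {x : V} (hx : x ∈ E) : g x ∈ E :=
  (mem_subspaceStabilizer.1 hg) ▸ Submodule.mem_map_of_mem (f := (g : V →ₗ[F] V)) hx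

theorem mem_subspaceStabilizer_of_forall_mem [FiniteDimensional F V] {g : V ≃ₗ[F] V}
    (hg : ∀ x ∈ E, g x ∈ E) : g ∈ subspaceStabilizer E := by
  refine mem_subspaceStabilizer.2 (Submodule.eq_of_le_of_finrank_eq ?_ ?_)
  · rintro _ ⟨x, hx, rfl⟩
    exact hg x hx
  · exact LinearEquiv.finrank_map_eq g E

theorem unipotentRadical_le_parabolicSubgroup : unipotentRadical β E ≤ parabolicSubgroup β E := by
  refine fun g hg => ⟨hg.1, mem_subspaceStabilizer.2 (le_antisymm ?_ ?_)⟩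
  · rintro _ ⟨x, hx, rfl⟩
    change g x ∈ E
    rwa [hg.2 x hx]
  · exact fun x hx => ⟨x, hx, hg.2 x hx⟩

theorem conj_mem_unipotentRadical {a g : V ≃ₗ[F] V} (ha : a ∈ parabolicSubgroup β E)
    (hg : g ∈ unipotentRadical β E) : a * g * a⁻¹ ∈ unipotentRadical β E := by
  refine ⟨mul_mem (mul_mem ha.1 hg.1) (inv_mem ha.1), fun x hx => ?_⟩
  have h : a⁻¹ x ∈ E := apply_mem_of_mem_subspaceStabilizer (inv_mem ha.2) hx
  change a (g (a⁻¹ x)) = x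
  rw [hg.2 _ h]
  exact a.apply_symm_apply x

theorem IsLagrangian.sub_mem (hE : IsLagrangian β E) {g : V ≃ₗ[F] V}
    (hg : g ∈ unipotentRadical β E) (y : V) : g y - y ∈ E := by
  refine (hE _).2 fun x hx => ?_
  have h := hg.1 x y
  rw [hg.2 x hx] at h
  rw [map_sub, h, sub_self]

theorem IsLagrangian.unipotentRadical_mul_apply (hE : IsLagrangian β E) {g h : V ≃ₗ[F] V}
    (hg : g ∈ unipotentRadical β E) (hh : h ∈ unipotentRadical β E) (y : V) :
    (g * h) y = y + (g y - y) + (h y - y) := by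
  have h1 := hg.2 _ (hE.sub_mem hh y)
  rw [map_sub, sub_eq_iff_eq_add] at h1
  change g (h y) = _
  rw [h1]
  abel

theorem IsLagrangian.unipotentRadical_mul_comm (hE : IsLagrangian β E) {g h : V ≃ₗ[F] V}
    (hg : g ∈ unipotentRadical β E) (hh : h ∈ unipotentRadical β E) : g * h = h * g := by
  refine LinearEquiv.ext fun y => ?_
  rw [hE.unipotentRadical_mul_apply hg hh, hE.unipotentRadical_mul_apply hh hg]
  abel

theorem IsLagrangian.unipotentRadical_pow_apply (hE : IsLagrangian β E) {g : V ≃ₗ[F] V}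
    (hg : g ∈ unipotentRadical β E) (y : V) (n : ℕ) : (g ^ n) y = y + n • (g y - y) := by
  induction n with
  | zero => simp
  | succ n ih =>
    rw [pow_succ, hE.unipotentRadical_mul_apply (pow_mem hg n) hg, ih, succ_nsmul]
    abel

/-- In characteristic `p` the unipotent radical is elementary abelian: its elements are `1 + N`
with `N` vanishing on `E` and taking values in `E`, so that `(1 + N) * (1 + N') = 1 + N + N'`. -/
theorem IsLagrangian.isElementaryAbelian_unipotentRadical (hE : IsLagrangian β E) (p : ℕ)
    [CharP F p] : IsElementaryAbelian p (unipotentRadical β E) := by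
  refine ⟨fun g h => Subtype.ext (hE.unipotentRadical_mul_comm g.2 h.2),
    fun g => Subtype.ext (LinearEquiv.ext fun y => ?_)⟩
  change ((g : V ≃ₗ[F] V) ^ p) y = y
  rw [hE.unipotentRadical_pow_apply g.2, ← Nat.cast_smul_eq_nsmul F, CharP.cast_eq_zero,
    zero_smul, add_zero]

theorem IsElementaryAbelian.of_le {p : ℕ} {Γ : Type*} [Group Γ] {N M : Subgroup Γ} (h : N ≤ M)
    (hM : IsElementaryAbelian p M) : IsElementaryAbelian p N := by
  refine ⟨fun x y => Subtype.ext ?_, fun x => Subtype.ext ?_⟩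
  · have h1 := hM.1 ⟨x, h x.2⟩ ⟨y, h y.2⟩
    exact (congrArg Subtype.val h1 :)
  · have h1 := hM.2 ⟨x, h x.2⟩
    exact (congrArg Subtype.val h1 :)

/-- Endomorphisms `N : V → E` vanishing on `E` and skew for `β` give the elements `1 + N` of the
unipotent radical. -/
theorem exists_mem_unipotentRadical_of_skew (hE : IsLagrangian β E)
    (N : V →ₗ[F] V) (hN : ∀ y, N y ∈ E) (hN0 : ∀ x ∈ E, N x = 0)
    (hs : ∀ x y, β x (N y) + β (N x) y = 0) :
    ∃ g ∈ unipotentRadical β E, ∀ y, g y = y + N y := by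
  refine ⟨LinearEquiv.ofLinearMap (LinearMap.id + N) (LinearMap.id - N) ?_ ?_,
    ⟨fun x y => ?_, fun x hx => ?_⟩, fun y => rfl⟩
  · ext y
    simp [hN0 _ (hN y)]
  · ext y
    simp [hN0 _ (hN y)]
  · change β (x + N x) (y + N y) = β x y
    have h0 := (hE _).1 (hN y) _ (hN x)
    have h1 := hs x y
    simp only [map_add, LinearMap.add_apply, h0]
    linear_combination h1
  · change x + N x = x
    rw [hN0 x hx, add_zero]

/-- Every vector outside the Lagrangian subspace `E` pairs to `1` with some vector of `E`. -/
theorem IsLagrangian.exists_apply_eq_one (hE : IsLagrangian β E) (hβ : β.IsSymm) {v : V}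
    (hv : v ∉ E) : ∃ x ∈ E, β x v = 1 := by
  have h : ∃ x ∈ E, β x v ≠ 0 := by
    by_contra! h
    exact hv ((hE v).2 h)
  obtain ⟨x, hx, hxv⟩ := h
  have hvx : β v x ≠ 0 := fun h => hxv (hβ.eq_iff.1 h)
  refine ⟨(β v x)⁻¹ • x, E.smul_mem _ hx, ?_⟩
  rw [LinearMap.map_smulₛₗ, LinearMap.smul_apply, smul_eq_mul, ← hβ.eq v x, map_inv₀,
    inv_mul_cancel₀]
  exact fun h => hvx ((map_eq_zero σ).1 h)

/-- The unipotent radical is transitive on the vectors of a coset `v + E` of norm `β v v`. -/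
theorem IsLagrangian.exists_unipotentRadical_apply_eq (hE : IsLagrangian β E) (hβ : β.IsSymm)
    {v w : V} (hv : v ∉ E) (hw : w ∈ E) (hvw : β (v + w) (v + w) = β v v) :
    ∃ g ∈ unipotentRadical β E, g v = v + w := by
  obtain ⟨x, hx, hxv⟩ := hE.exists_apply_eq_one hβ hv
  have hEE : ∀ a ∈ E, ∀ c ∈ E, β a c = 0 := fun a ha c hc => (hE c).1 hc a ha
  have hsk : β v w = - β w v := by
    have := hEE w hw w hw
    simp only [map_add, LinearMap.add_apply] at hvw
    linear_combination hvw - this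
  -- The first two terms form a skew map sending `v` to `w - β w v • x`; as `β w v` has trace
  -- zero, the third term is skew too, and it corrects the value at `v`.
  obtain ⟨g, hg, hgy⟩ := exists_mem_unipotentRadical_of_skew hE
    ((β x).smulRight w - (β w).smulRight x + (β w v • β x).smulRight x)
    (fun y => by
      simp only [LinearMap.add_apply, LinearMap.sub_apply, LinearMap.smulRight_apply]
      exact E.add_mem (E.sub_mem (E.smul_mem _ hw) (E.smul_mem _ hx)) (E.smul_mem _ hx))
    (fun y hy => by simp [hEE x hx y hy, hEE w hw y hy])
    (fun y z => by
      have h1 : σ (β x y) = β y x := hβ.eq _ _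
      have h2 : σ (β w y) = β y w := hβ.eq _ _
      have h3 : σ (β w v) = - β w v := by rw [hβ.eq, hsk]
      simp only [LinearMap.add_apply, LinearMap.sub_apply, LinearMap.smulRight_apply, map_add,
        map_sub, LinearMap.map_smulₛₗ, LinearMap.smul_apply, smul_eq_mul, RingHom.id_apply,
        map_mul, h1, h2, h3]
      ring)
  refine ⟨g, hg, ?_⟩
  rw [hgy]
  simp [hxv]

end Lagrangian

/-! ### Adapted bases and the Levi factor -/

section WittBasis

variable {F V ι : Type*} [Field F] [AddCommGroup V] [Module F V] {σ : F →+* F}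
  {β : V →ₛₗ[σ] V →ₗ[F] F} {b : Module.Basis (ι ⊕ ι) F V}

/-- The basis `b`, consisting of the `e i = b (Sum.inl i)` and the `f i = b (Sum.inr i)`, is
adapted to `β`: the `e i` and the `f i` span totally singular subspaces, and they are dual to
each other. -/
structure IsWittBasis [DecidableEq ι] (β : V →ₛₗ[σ] V →ₗ[F] F)
    (b : Module.Basis (ι ⊕ ι) F V) : Prop where
  inl_inl : ∀ i j, β (b (Sum.inl i)) (b (Sum.inl j)) = 0
  inr_inr : ∀ i j, β (b (Sum.inr i)) (b (Sum.inr j)) = 0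
  inl_inr : ∀ i j, β (b (Sum.inl i)) (b (Sum.inr j)) = if i = j then 1 else 0

/-- The span of the vectors `e i`. -/
def inlSpan (b : Module.Basis (ι ⊕ ι) F V) : Submodule F V :=
  Submodule.span F (Set.range fun i => b (Sum.inl i))

/-- The span of the vectors `f i`. -/
def inrSpan (b : Module.Basis (ι ⊕ ι) F V) : Submodule F V :=
  Submodule.span F (Set.range fun i => b (Sum.inr i))

theorem inl_mem_inlSpan (i : ι) : b (Sum.inl i) ∈ inlSpan b := Submodule.subset_span ⟨i, rfl⟩

theorem inr_mem_inrSpan (i : ι) : b (Sum.inr i) ∈ inrSpan b := Submodule.subset_span ⟨i, rfl⟩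

namespace IsWittBasis

variable [DecidableEq ι]

theorem inr_inl (hb : IsWittBasis β b) (hβ : β.IsSymm) (i j : ι) :
    β (b (Sum.inr i)) (b (Sum.inl j)) = if i = j then 1 else 0 := by
  rw [← hβ.eq, hb.inl_inr]
  split_ifs <;> simp_all

theorem apply_eq_zero_of_mem_inlSpan (hb : IsWittBasis β b) {x y : V} (hx : x ∈ inlSpan b)
    (hy : y ∈ inlSpan b) : β x y = 0 := by
  refine LinearMap.mem_ker.1 ((Submodule.span_le (p := LinearMap.ker (β x))).2 ?_ hy)
  rintro _ ⟨j, rfl⟩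
  refine LinearMap.mem_ker.1
    ((Submodule.span_le (p := LinearMap.ker (β.flip (b (Sum.inl j))))).2 ?_ hx)
  rintro _ ⟨i, rfl⟩
  exact hb.inl_inl i j

theorem apply_eq_zero_of_mem_inrSpan (hb : IsWittBasis β b) {x y : V} (hx : x ∈ inrSpan b)
    (hy : y ∈ inrSpan b) : β x y = 0 := by
  refine LinearMap.mem_ker.1 ((Submodule.span_le (p := LinearMap.ker (β x))).2 ?_ hy)
  rintro _ ⟨j, rfl⟩
  refine LinearMap.mem_ker.1
    ((Submodule.span_le (p := LinearMap.ker (β.flip (b (Sum.inr j))))).2 ?_ hx)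
  rintro _ ⟨i, rfl⟩
  exact hb.inr_inr i j

variable [Fintype ι]

theorem sum_smul_add_sum_smul (hb : IsWittBasis β b) (hβ : β.IsSymm) (y : V) :
    ∑ i, β (b (Sum.inr i)) y • b (Sum.inl i) + ∑ i, β (b (Sum.inl i)) y • b (Sum.inr i) = y := by
  have hl : ∀ i, β (b (Sum.inl i)) y = b.repr y (Sum.inr i) := fun i => by
    conv_lhs => rw [← b.sum_repr y, Fintype.sum_sum_type]
    simp only [map_add, map_sum, map_smul, hb.inl_inl, hb.inl_inr]
    simp
  have hr : ∀ i, β (b (Sum.inr i)) y = b.repr y (Sum.inl i) := fun i => by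
    conv_lhs => rw [← b.sum_repr y, Fintype.sum_sum_type]
    simp only [map_add, map_sum, map_smul, hb.inr_inr, hb.inr_inl hβ]
    simp
  conv_rhs => rw [← b.sum_repr y, Fintype.sum_sum_type]
  simp only [hl, hr]

theorem isLagrangian (hb : IsWittBasis β b) (hβ : β.IsSymm) : IsLagrangian β (inlSpan b) := by
  refine fun y => ⟨fun hy x hx => hb.apply_eq_zero_of_mem_inlSpan hx hy, fun h => ?_⟩
  rw [← hb.sum_smul_add_sum_smul hβ y]
  simp only [h _ (inl_mem_inlSpan _), zero_smul, Finset.sum_const_zero, add_zero]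
  exact Submodule.sum_mem _ fun i _ => Submodule.smul_mem _ _ (inl_mem_inlSpan i)

theorem sum_smul_of_mem_inlSpan (hb : IsWittBasis β b) (hβ : β.IsSymm) {x : V}
    (hx : x ∈ inlSpan b) : ∑ i, β (b (Sum.inr i)) x • b (Sum.inl i) = x := by
  conv_rhs => rw [← hb.sum_smul_add_sum_smul hβ x]
  simp [((hb.isLagrangian hβ) x).1 hx _ (inl_mem_inlSpan _)]

theorem eq_zero_of_mem_of_mem (hb : IsWittBasis β b) (hβ : β.IsSymm) {x : V}
    (hx : x ∈ inlSpan b) (hx' : x ∈ inrSpan b) : x = 0 := by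
  rw [← hb.sum_smul_of_mem_inlSpan hβ hx]
  simp [hb.apply_eq_zero_of_mem_inrSpan (inr_mem_inrSpan _) hx']

/-- Every linear automorphism `t` of `E = inlSpan b` extends to an element of the Levi factor:
it acts on `E' = inrSpan b` by the inverse of the adjoint of `t` with respect to the pairing of
`E` and `E'`. -/
theorem exists_mem_leviFactor (hb : IsWittBasis β b) (hβ : β.IsSymm) (hβ' : β.Nondegenerate)
    (t : inlSpan b ≃ₗ[F] inlSpan b) :
    ∃ g ∈ leviFactor β (inlSpan b) (inrSpan b), ∀ x : inlSpan b, ((t x : inlSpan b) : V) = g x := by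
  have : FiniteDimensional F V := b.finiteDimensional_of_finite
  let e : ι → inlSpan b := fun i => ⟨b (Sum.inl i), inl_mem_inlSpan i⟩
  let π : V →ₗ[F] inlSpan b := ∑ i, (β (b (Sum.inr i))).smulRight (e i)
  let τ : V →ₗ[F] V := ∑ i, (β (t.symm (e i) : inlSpan b)).smulRight (b (Sum.inr i))
  have hπv : ∀ y, ((π y : inlSpan b) : V) = ∑ i, β (b (Sum.inr i)) y • b (Sum.inl i) := fun y => by
    simp [π, e]
  have hτv : ∀ y, τ y = ∑ i, β (t.symm (e i) : inlSpan b) y • b (Sum.inr i) := fun y => by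
    simp [τ]
  have hτmem : ∀ y, τ y ∈ inrSpan b := fun y => by
    rw [hτv]
    exact Submodule.sum_mem _ fun i _ => Submodule.smul_mem _ _ (inr_mem_inrSpan i)
  have hπE : ∀ x : inlSpan b, π x = x := fun x =>
    Subtype.ext (by rw [hπv, hb.sum_smul_of_mem_inlSpan hβ x.2])
  have hEE : ∀ x z : inlSpan b, β x z = 0 := fun x z =>
    hb.apply_eq_zero_of_mem_inlSpan x.2 z.2
  have hτE : ∀ x : inlSpan b, τ x = 0 := fun x => by
    simp [hτv, hEE]
  -- `τ` is the inverse adjoint of `t`.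
  have hadj : ∀ (z : inlSpan b) (y : V), β z (τ y) = β (t.symm z : inlSpan b) y := fun z y => by
    have hz : z = ∑ i, β (b (Sum.inr i)) z • e i := by
      conv_lhs => rw [← hπE z]
      simp [π]
    have h1 : ((t.symm z : inlSpan b) : V) =
        ∑ i, β (b (Sum.inr i)) z • ((t.symm (e i) : inlSpan b) : V) := by
      conv_lhs => rw [hz]
      simp
    rw [h1, hτv]
    simp only [map_sum, LinearMap.map_smulₛₗ, LinearMap.sum_apply, LinearMap.smul_apply,
      smul_eq_mul, hβ.eq, RingHom.id_apply]
    exact Finset.sum_congr rfl fun i _ => mul_comm _ _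
  let g₀ : V →ₗ[F] V := (inlSpan b).subtype ∘ₗ (t : inlSpan b →ₗ[F] inlSpan b) ∘ₗ π + τ
  have hg₀ : ∀ y, g₀ y = (t (π y) : inlSpan b) + τ y := fun y => rfl
  have hiso : ∀ x y, β (g₀ x) (g₀ y) = β x y := fun x y => by
    have h1 : β (t (π x) : inlSpan b) (τ y) = β (π x) y := by simp [hadj]
    have h2 : β (τ x) (t (π y) : inlSpan b) = β x (π y) := by
      rw [← hβ.eq, hadj, LinearEquiv.symm_apply_apply, hβ.eq]
    have h3 : β (τ x) (τ y) = 0 := hb.apply_eq_zero_of_mem_inrSpan (hτmem x) (hτmem y)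
    have h4 : ∀ z, z - π z ∈ inrSpan b := fun z => by
      rw [hπv, sub_eq_of_eq_add' (hb.sum_smul_add_sum_smul hβ z).symm]
      exact Submodule.sum_mem _ fun i _ => Submodule.smul_mem _ _ (inr_mem_inrSpan i)
    have h5 := hb.apply_eq_zero_of_mem_inrSpan (h4 x) (h4 y)
    have h6 := hEE (π x) (π y)
    have h7 := hEE (t (π x)) (t (π y))
    simp only [hg₀, map_add, LinearMap.add_apply, h1, h2, h3, h7]
    simp only [map_sub, LinearMap.sub_apply, h6] at h5
    linear_combination -h5
  have hinj : Function.Injective g₀ := by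
    refine (injective_iff_map_eq_zero g₀).2 fun x hx => hβ'.1 x fun y => ?_
    rw [← hiso, hx, map_zero, LinearMap.zero_apply]
  refine ⟨LinearEquiv.ofInjectiveEndo g₀ hinj, ⟨⟨hiso, ?_⟩, ?_⟩, fun x => ?_⟩
  · refine mem_subspaceStabilizer_of_forall_mem fun x hx => ?_
    change g₀ x ∈ _
    rw [hg₀, hτE ⟨x, hx⟩, add_zero]
    exact Subtype.prop _
  · refine mem_subspaceStabilizer_of_forall_mem fun x hx => ?_
    change g₀ x ∈ _
    have : π x = 0 := Subtype.ext <| by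
      simp [hπv, hb.apply_eq_zero_of_mem_inrSpan (inr_mem_inrSpan _) hx]
    rw [hg₀, this, map_zero, Submodule.coe_zero, zero_add]
    exact hτmem x
  · change _ = g₀ x
    rw [hg₀, hτE, add_zero, hπE]

end IsWittBasis

end WittBasis

/-! ### Counting skew-hermitian matrices and the order of the unipotent radical -/

section Counting

theorem exists_pow_ne_of_card_eq_sq {F : Type*} [Field F] {q : ℕ} (hq : 1 < q)
    (hF : Nat.card F = q ^ 2) : ∃ d : F, d ^ q ≠ d := by
  have : Finite F := Nat.finite_of_card_ne_zero (by rw [hF]; positivity)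
  have := Fintype.ofFinite F
  by_contra! h
  have hdvd : Fintype.card F - 1 ∣ q - 1 := by
    rw [← FiniteField.forall_pow_eq_one_iff F]
    intro x
    refine Units.ext ?_
    have hx : (x : F) ^ (q - 1) * x = 1 * x := by
      rw [← pow_succ, Nat.sub_add_cancel hq.le, h, one_mul]
    simpa using mul_right_cancel₀ x.ne_zero hx
  have hle := Nat.le_of_dvd (by omega) hdvd
  rw [← Nat.card_eq_fintype_card, hF] at hle
  have : q < q ^ 2 := by nlinarith
  omega

/-- Let `s` be a `σ`-semilinear involution of a vector space `M` over `F`, where `σ ≠ 1`.  For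
`d` with `σ d ≠ d` one has `M = M⁻ ⊕ d • M⁻`, where `M⁻` is the set of the skew elements of `M`. -/
theorem card_skew_sq {F M : Type*} [Field F] [AddCommGroup M] [Module F M] {σ : F →+* F}
    (hσ : ∀ a, σ (σ a) = a) {d : F} (hd : σ d ≠ d) (s : M →+ M)
    (hs : ∀ (a : F) x, s (a • x) = σ a • s x) (hss : ∀ x, s (s x) = x) :
    Nat.card {x // s x = -x} ^ 2 = Nat.card M := by
  have hd' : d - σ d ≠ 0 := sub_ne_zero.2 hd.symm
  rw [sq, ← Nat.card_prod]
  refine Nat.card_eq_of_bijective (fun z : {x // s x = -x} × {x // s x = -x} =>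
    (z.1 : M) + d • (z.2 : M)) ⟨?_, fun z => ?_⟩
  · rintro ⟨⟨x, hx⟩, ⟨y, hy⟩⟩ ⟨⟨x', hx'⟩, ⟨y', hy'⟩⟩ h
    simp only at h
    have h2 := congrArg s h
    simp only [map_add, hs, hx, hy, hx', hy'] at h2
    have h3 : (d - σ d) • (y - y') = 0 := by
      linear_combination (norm := module) h + h2
    have hyy : y = y' := sub_eq_zero.1 ((smul_eq_zero.1 h3).resolve_left hd')
    subst hyy
    have hxx : x = x' := add_right_cancel h
    subst hxx
    rfl
  · have hy : (d - σ d) • ((d - σ d)⁻¹ • (z + s z)) = z + s z := smul_inv_smul₀ hd' _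
    set y := (d - σ d)⁻¹ • (z + s z) with hydef
    have hsy : s y = -y := by
      rw [hydef, hs, map_inv₀, map_sub, hσ, map_add, hss, ← neg_sub, inv_neg, neg_smul,
        add_comm (s z)]
    refine ⟨⟨⟨z - d • y, ?_⟩, ⟨y, hsy⟩⟩, sub_add_cancel _ _⟩
    rw [map_sub, hs, hsy]
    rw [sub_smul] at hy
    linear_combination (norm := module) -hy

variable {F V ι : Type*} [Field F] [AddCommGroup V] [Module F V] {σ : F →+* F}
  {β : V →ₛₗ[σ] V →ₗ[F] F} [DecidableEq ι] [Fintype ι] {b : Module.Basis (ι ⊕ ι) F V}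

/-- Taking the matrix of the form `β x (g y)` in the vectors `f i` identifies the unipotent
radical of the stabilizer of `E` with the group of skew-hermitian matrices. -/
theorem IsWittBasis.card_unipotentRadical_sq (hb : IsWittBasis β b) (hβ : β.IsSymm)
    (hσ : ∀ a, σ (σ a) = a) {d : F} (hd : σ d ≠ d) :
    Nat.card (unipotentRadical β (inlSpan b)) ^ 2 = Nat.card F ^ (Fintype.card ι ^ 2) := by
  have hE := hb.isLagrangian hβ
  let s : (ι × ι → F) →+ (ι × ι → F) :=
    { toFun := fun M ij => σ (M (ij.2, ij.1))
      map_zero' := by ext; simp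
      map_add' := fun _ _ => by ext; simp }
  have hs : ∀ (M : ι × ι → F) i j, s M (i, j) = σ (M (j, i)) := fun _ _ _ => rfl
  have key := card_skew_sq hσ hd s (fun a M => by ext ij; simp [s]) (fun M => by ext; simp [s, hσ])
  rw [Nat.card_fun, Nat.card_prod, Nat.card_eq_fintype_card (α := ι), ← sq] at key
  rw [← key]
  congr 1
  have hskew : ∀ g ∈ unipotentRadical β (inlSpan b),
      s (fun ij => β (b (Sum.inr ij.1)) (g (b (Sum.inr ij.2)))) =
        -(fun ij => β (b (Sum.inr ij.1)) (g (b (Sum.inr ij.2)))) := fun g hg => by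
    funext ⟨i, j⟩
    have h1 := hE.sub_mem hg (b (Sum.inr i))
    have h2 := hE.sub_mem hg (b (Sum.inr j))
    have h3 := (hE _).1 h2 _ h1
    have h4 := hg.1 (b (Sum.inr i)) (b (Sum.inr j))
    simp only [hs, hβ.eq, Pi.neg_apply]
    simp only [map_sub, LinearMap.sub_apply, h4, hb.inr_inr] at h3
    linear_combination -h3
  refine Nat.card_eq_of_bijective (fun g => ⟨_, hskew g g.2⟩) ⟨?_, ?_⟩
  · rintro ⟨g, hg⟩ ⟨h, hh⟩ hgh
    have hgh' : ∀ i j, β (b (Sum.inr i)) (g (b (Sum.inr j))) =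
        β (b (Sum.inr i)) (h (b (Sum.inr j))) := fun i j =>
      congrFun (congrArg Subtype.val hgh) (i, j)
    refine Subtype.ext (LinearEquiv.toLinearMap_injective (b.ext ?_))
    rintro (j | j)
    · change g _ = h _
      rw [hg.2 _ (inl_mem_inlSpan j), hh.2 _ (inl_mem_inlSpan j)]
    · change g _ = h _
      have hmem : g (b (Sum.inr j)) - h (b (Sum.inr j)) ∈ inlSpan b := by
        rw [← sub_sub_sub_cancel_right _ _ (b (Sum.inr j))]
        exact sub_mem (hE.sub_mem hg _) (hE.sub_mem hh _)
      rw [← sub_eq_zero, ← hb.sum_smul_of_mem_inlSpan hβ hmem]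
      simp [hgh']
  · rintro ⟨M, hM⟩
    have hM' : ∀ i j, σ (M (j, i)) = - M (i, j) := fun i j => congrFun hM (i, j)
    let N : V →ₗ[F] V := ∑ i, ∑ j, (M (i, j) • β (b (Sum.inl j))).smulRight (b (Sum.inl i))
    have hN : ∀ y, N y = ∑ i, ∑ j, (M (i, j) * β (b (Sum.inl j)) y) • b (Sum.inl i) := fun y => by
      simp [N]
    obtain ⟨g, hg, hgN⟩ := exists_mem_unipotentRadical_of_skew hE N
      (fun y => by
        rw [hN]
        exact Submodule.sum_mem _ fun i _ => Submodule.sum_mem _ fun j _ =>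
          Submodule.smul_mem _ _ (inl_mem_inlSpan i))
      (fun x hx => by
        simp [hN, (hE _).1 hx _ (inl_mem_inlSpan _)])
      (fun x y => by
        simp only [hN, map_sum, map_smul, LinearMap.map_smulₛₗ, LinearMap.sum_apply,
          LinearMap.smul_apply, smul_eq_mul, map_mul, hM', hβ.eq]
        rw [Finset.sum_comm, ← Finset.sum_add_distrib]
        refine Finset.sum_eq_zero fun i _ => ?_
        rw [← Finset.sum_add_distrib]
        exact Finset.sum_eq_zero fun j _ => by ring)
    refine ⟨⟨g, hg⟩, Subtype.ext (funext fun ⟨i, j⟩ => ?_)⟩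
    change β (b (Sum.inr i)) (g (b (Sum.inr j))) = M (i, j)
    simp [hgN, hN, hb.inr_inr, hb.inr_inl hβ, hb.inl_inr]

/-- Orbit counting: the orbit of `v` under the unipotent radical consists of the vectors `v + w`
with `w ∈ E` and `β v w` of trace zero. -/
theorem IsLagrangian.card_unipotentRadical_inf_mul {F V : Type*} [Field F] [AddCommGroup V]
    [Module F V] {σ : F →+* F} {β : V →ₛₗ[σ] V →ₗ[F] F} {E : Submodule F V}
    (hE : IsLagrangian β E) (hβ : β.IsSymm) (hσ : ∀ a, σ (σ a) = a) {d : F} (hd : σ d ≠ d)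
    {q : ℕ} (hq : 0 < q) (hF : Nat.card F = q ^ 2) {v : V} (hv : v ∉ E) :
    Nat.card (unipotentRadical β E ⊓ (unitaryIsometryGroup β ⊓ vectorStabilizer v) :
      Subgroup (V ≃ₗ[F] V)) * Nat.card E = q * Nat.card (unipotentRadical β E) := by
  have : Finite F := Nat.finite_of_card_ne_zero (by rw [hF]; positivity)
  let δ : unipotentRadical β E →* Multiplicative E :=
    { toFun := fun g => Multiplicative.ofAdd ⟨(g : V ≃ₗ[F] V) v - v, hE.sub_mem g.2 v⟩
      map_one' := by
        refine congrArg Multiplicative.ofAdd (Subtype.ext ?_)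
        exact sub_self v
      map_mul' := fun g h => by
        refine congrArg Multiplicative.ofAdd (Subtype.ext ?_)
        change ((g : V ≃ₗ[F] V) * h) v - v = ((g : V ≃ₗ[F] V) v - v) + ((h : V ≃ₗ[F] V) v - v)
        rw [hE.unipotentRadical_mul_apply g.2 h.2]
        abel }
  have hδ : ∀ g, ((Multiplicative.toAdd (δ g) : E) : V) = (g : V ≃ₗ[F] V) v - v := fun _ => rfl
  let Z : AddSubgroup F := (σ.toAddMonoidHom + AddMonoidHom.id F).ker
  have hZ : ∀ a, a ∈ Z ↔ σ a = -a := fun a => eq_neg_iff_add_eq_zero.symm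
  have hZq : Z.index = q := by
    have h1 : Nat.card Z ^ 2 = q ^ 2 := by
      rw [← hF, ← card_skew_sq hσ hd σ.toAddMonoidHom (fun a x => by simp) (fun x => hσ x)]
      congr 1
      exact Nat.card_congr (Equiv.subtypeEquivRight hZ)
    have h2 : Nat.card Z = q := Nat.pow_left_injective two_ne_zero h1
    have h3 := Z.card_mul_index
    rw [h2, hF, sq] at h3
    exact Nat.eq_of_mul_eq_mul_left hq h3
  let ℓ : E →+ F := ((β v).domRestrict E).toAddMonoidHom
  have hℓ : ∀ x : E, ℓ x = β v x := fun _ => rfl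
  have hℓsurj : Function.Surjective ℓ := by
    obtain ⟨x, hx, hxv⟩ := hE.exists_apply_eq_one hβ hv
    refine fun a => ⟨⟨a • x, E.smul_mem _ hx⟩, ?_⟩
    rw [hℓ, map_smul, ← hβ.eq, hxv, map_one, smul_eq_mul, mul_one]
  have hrange : Nat.card δ.range = Nat.card (Z.comap ℓ) := by
    refine Nat.card_congr (Equiv.subtypeEquiv Multiplicative.toAdd fun w => ?_)
    have hww : β (Multiplicative.toAdd w : E) (Multiplicative.toAdd w : E) = 0 :=
      (hE _).1 (Multiplicative.toAdd w).2 _ (Multiplicative.toAdd w).2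
    rw [AddSubgroup.mem_comap, hZ, hℓ, MonoidHom.mem_range]
    constructor
    · rintro ⟨g, rfl⟩
      have h1 := g.2.1 v v
      rw [hδ] at hww ⊢
      rw [hβ.eq]
      simp only [map_sub, LinearMap.sub_apply, h1] at hww ⊢
      linear_combination -hww
    · intro h
      obtain ⟨g, hg, hgv⟩ := hE.exists_unipotentRadical_apply_eq hβ hv
        (Multiplicative.toAdd w).2 (by
          rw [hβ.eq] at h
          simp only [map_add, LinearMap.add_apply, hww, h]
          ring)
      refine ⟨⟨g, hg⟩, Multiplicative.toAdd.injective (Subtype.ext ?_)⟩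
      rw [hδ]
      exact sub_eq_of_eq_add' hgv
  have hker : Nat.card δ.ker = Nat.card (unipotentRadical β E ⊓
      (unitaryIsometryGroup β ⊓ vectorStabilizer v) : Subgroup (V ≃ₗ[F] V)) := by
    refine Nat.card_eq_of_bijective (fun g => ⟨(g : unipotentRadical β E), ?_⟩) ⟨?_, ?_⟩
    · refine ⟨g.1.2, g.1.2.1, ?_⟩
      have h1 := congrArg (fun w => ((Multiplicative.toAdd w : E) : V)) (MonoidHom.mem_ker.1 g.2)
      exact sub_eq_zero.1 h1
    · rintro ⟨⟨g, hg⟩, hg'⟩ ⟨⟨h, hh⟩, hh'⟩ hgh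
      exact Subtype.ext (Subtype.ext (congrArg Subtype.val hgh :))
    · rintro ⟨g, hg, hg', hgv⟩
      refine ⟨⟨⟨g, hg⟩, MonoidHom.mem_ker.2
        (Multiplicative.toAdd.injective (Subtype.ext ?_))⟩, rfl⟩
      rw [hδ]
      exact sub_eq_zero.2 hgv
  have h1 := δ.ker.card_mul_index
  have h2 := (Z.comap ℓ).card_mul_index
  rw [Subgroup.index_ker, hrange, hker] at h1
  rw [AddSubgroup.index_comap_of_surjective _ hℓsurj, hZq] at h2
  rw [← h1, ← h2]
  ring

end Counting

/-! ### Singer cycles -/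

section Singer

variable {F : Type u} {U : Type w} [Field F] [AddCommGroup U] [Module F U]
  {T : Subgroup (U ≃ₗ[F] U)}

theorem IsSingerCycle.mul_comm (hT : IsSingerCycle T) {s t : U ≃ₗ[F] U} (hs : s ∈ T)
    (ht : t ∈ T) : s * t = t * s := by
  obtain ⟨L, _, _, φ, h⟩ := hT
  obtain ⟨a, ha⟩ := (h s).1 hs
  obtain ⟨c, hc⟩ := (h t).1 ht
  refine LinearEquiv.ext fun x => φ.injective ?_
  change φ (s (t x)) = φ (t (s x))
  rw [ha, hc, hc, ha, mul_left_comm]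

theorem IsSingerCycle.exists_apply_sub_eq (hT : IsSingerCycle T) {t : U ≃ₗ[F] U} (ht : t ∈ T)
    (ht1 : t ≠ 1) (y : U) : ∃ x, t x - x = y := by
  obtain ⟨L, _, _, φ, h⟩ := hT
  obtain ⟨a, ha⟩ := (h t).1 ht
  have ha1 : (a : L) - 1 ≠ 0 := fun h0 => ht1 <| LinearEquiv.ext fun x => φ.injective <| by
    rw [ha, sub_eq_zero.1 h0, one_mul]
    rfl
  refine ⟨φ.symm (((a : L) - 1)⁻¹ * φ y), φ.injective ?_⟩
  rw [map_sub, ha, LinearEquiv.apply_symm_apply, ← sub_one_mul, mul_inv_cancel_left₀ ha1]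

/-- Multiplication by an element of `L`, as an element of a Singer cycle. -/
theorem exists_singer_apply {L : Type w} [Field L] [Algebra F L] (φ : U ≃ₗ[F] L)
    (h : ∀ g : U ≃ₗ[F] U, g ∈ T ↔ ∃ a : Lˣ, ∀ x : U, φ (g x) = (a : L) * φ x) (a : Lˣ) :
    ∃ t ∈ T, ∀ x, φ (t x) = (a : L) * φ x := by
  let m : L ≃ₗ[F] L := LinearEquiv.ofLinearMap (LinearMap.mulLeft F (a : L))
    (LinearMap.mulLeft F ((a⁻¹ : Lˣ) : L)) (LinearMap.ext fun x => a.mul_inv_cancel_left x)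
    (LinearMap.ext fun x => a.inv_mul_cancel_left x)
  have hm : ∀ x, φ (φ.symm (m (φ x))) = (a : L) * φ x := fun x => φ.apply_symm_apply _
  exact ⟨(φ.trans m).trans φ.symm, (h _).2 ⟨a, hm⟩, hm⟩

theorem IsSingerCycle.exists_apply_eq (hT : IsSingerCycle T) {x y : U} (hx : x ≠ 0)
    (hy : y ≠ 0) : ∃ t ∈ T, t x = y := by
  obtain ⟨L, _, _, φ, h⟩ := hT
  have hx' : φ x ≠ 0 := by simpa using hx
  have hy' : φ y ≠ 0 := by simpa using hy
  obtain ⟨t, ht, htx⟩ := exists_singer_apply φ h (Units.mk0 (φ y / φ x) (div_ne_zero hy' hx'))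
  refine ⟨t, ht, φ.injective ?_⟩
  rw [htx, Units.val_mk0, div_mul_cancel₀ _ hx']

/-- A Singer cycle is also transitive on the nonzero functionals: if `λ` is a nonzero functional
on `L`, then `a ↦ (x ↦ λ (a * x))` is a linear bijection from `L` onto its dual space. -/
theorem IsSingerCycle.exists_functional_apply_eq [FiniteDimensional F U] (hT : IsSingerCycle T)
    {ℓ μ : U →ₗ[F] F} (hℓ : ℓ ≠ 0) (hμ : μ ≠ 0) : ∃ t ∈ T, ∀ x, ℓ (t x) = μ x := by
  obtain ⟨L, _, _, φ, h⟩ := hT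
  have : FiniteDimensional F L := φ.finiteDimensional
  let Φ : L →ₗ[F] Module.Dual F L := (LinearMap.mul F L).compr₂ (ℓ ∘ₗ φ.symm.toLinearMap)
  have hΦ : ∀ a x, Φ a x = ℓ (φ.symm (a * x)) := fun _ _ => rfl
  have hinj : Function.Injective Φ := by
    refine (injective_iff_map_eq_zero Φ).2 fun a ha => ?_
    by_contra ha0
    refine hℓ (LinearMap.ext fun x => ?_)
    have h1 := LinearMap.congr_fun ha (a⁻¹ * φ x)
    rwa [hΦ, mul_inv_cancel_left₀ ha0, LinearEquiv.symm_apply_apply] at h1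
  obtain ⟨a, ha⟩ := (LinearMap.injective_iff_surjective_of_finrank_eq_finrank
    Subspace.dual_finrank_eq.symm).1 hinj (μ ∘ₗ φ.symm.toLinearMap)
  have ha0 : a ≠ 0 := fun h0 => hμ <| LinearMap.ext fun x => by
    have h1 := LinearMap.congr_fun ha (φ x)
    rw [h0, map_zero] at h1
    simpa using h1.symm
  obtain ⟨t, ht, htx⟩ := exists_singer_apply φ h (Units.mk0 a ha0)
  refine ⟨t, ht, fun x => ?_⟩
  have h1 := LinearMap.congr_fun ha (φ x)
  rw [hΦ] at h1
  rw [← φ.symm_apply_apply (t x), htx, Units.val_mk0, h1]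
  simp

theorem IsSingerCycle.nonempty_mulEquiv {p n : ℕ} [Fact p.Prime] (hT : IsSingerCycle T)
    (hU : Nat.card U = p ^ n) :
    Nonempty (T ≃* Matrix.GeneralLinearGroup (Fin 1) (GaloisField p n)) := by
  obtain ⟨L, _, _, φ, h⟩ := hT
  have hL : Nat.card L = p ^ n := by rw [← hU, Nat.card_congr φ.toEquiv]
  have : Finite L := Nat.finite_of_card_ne_zero (by
    rw [hL]
    exact pow_ne_zero _ (Fact.out : p.Prime).ne_zero)
  have := Fintype.ofFinite L
  have : CharP L p := charP_of_card_eq_prime_pow (f := n) (by rw [← Nat.card_eq_fintype_card, hL])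
  let _ := ZMod.algebra L p
  have e₁ : L ≃+* GaloisField p n := (GaloisField.algEquivGaloisField p n hL).toRingEquiv
  have e₂ : Lˣ ≃* Matrix.GeneralLinearGroup (Fin 1) (GaloisField p n) :=
    (Units.mapEquiv e₁.toMulEquiv).trans (Units.mapEquiv
      (Matrix.uniqueRingEquiv (m := Fin 1) (A := GaloisField p n)).symm.toMulEquiv)
  choose c hc using fun t : T => (h t).1 t.2
  have hone : φ.symm 1 ≠ 0 := by simp
  let κ : T →* Lˣ := MonoidHom.mk' c fun s t => Units.ext <| by
    have h1 := hc (s * t) (φ.symm 1)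
    change φ ((s : U ≃ₗ[F] U) ((t : U ≃ₗ[F] U) _)) = _ at h1
    rw [hc, hc, φ.apply_symm_apply, mul_one, mul_one] at h1
    exact h1.symm
  have hκ : Function.Bijective κ := by
    refine ⟨fun s t hst => ?_, fun a => ?_⟩
    · refine Subtype.ext (LinearEquiv.ext fun x => φ.injective ?_)
      have h1 : c s = c t := hst
      rw [hc, hc, h1]
    · obtain ⟨t, ht, htx⟩ := exists_singer_apply φ h a
      refine ⟨⟨t, ht⟩, Units.ext ?_⟩
      have h1 := hc ⟨t, ht⟩ (φ.symm 1)
      rw [htx, φ.apply_symm_apply, mul_one, mul_one] at h1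
      exact h1.symm
  exact ⟨(MulEquiv.ofBijective κ hκ).trans e₂⟩

end Singer

/-! ### The stabilizer of a nonisotropic vector -/

section Restriction

variable {F V : Type*} [Field F] [AddCommGroup V] [Module F V]

/-- Restriction to an invariant subspace, as a group homomorphism. -/
def restrictHom (E : Submodule F V) : subspaceStabilizer E →* (E ≃ₗ[F] E) where
  toFun g := (g : V ≃ₗ[F] V).ofSubmodules E E g.2
  map_one' := rfl
  map_mul' _ _ := rfl

variable {σ : F →+* F} {β : V →ₛₗ[σ] V →ₗ[F] F}

theorem apply_sub_smul_eq_zero {v : V} (hv : β v v ≠ 0) (y : V) :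
    β v (y - (β v y / β v v) • v) = 0 := by
  rw [map_sub, map_smul, smul_eq_mul, div_mul_cancel₀ _ hv, sub_self]

theorem nondegenerate_domRestrict_ker (hβ : β.IsSymm) (hβ' : β.Nondegenerate) {v : V}
    (hv : β v v ≠ 0) :
    (β.domRestrict₁₂ (LinearMap.ker (β v)) (LinearMap.ker (β v))).Nondegenerate := by
  have h0 : ∀ x : LinearMap.ker (β v), β x v = 0 := fun x => hβ.eq_iff.1 x.2
  have h : ∀ x : LinearMap.ker (β v), (∀ y : LinearMap.ker (β v), β x y = 0) → x = 0 := by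
    refine fun x hx => Subtype.ext (hβ'.1 _ fun y => ?_)
    have h1 := hx ⟨_, apply_sub_smul_eq_zero hv y⟩
    rwa [map_sub, map_smul, h0, smul_zero, sub_zero] at h1
  exact ⟨fun x hx => h x hx, fun x hx => h x fun y => hβ.eq_iff.1 (hx y)⟩

theorem finrank_ker_apply [FiniteDimensional F V] {v : V} (hv : β v v ≠ 0) :
    Module.finrank F (LinearMap.ker (β v)) = Module.finrank F V - 1 := by
  have h : β v ≠ 0 := fun h => hv (by rw [h, LinearMap.zero_apply])
  rw [← Module.Dual.finrank_ker_add_one_of_ne_zero (f := β v) h, Nat.add_sub_cancel]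

theorem mem_subspaceStabilizer_ker {g : V ≃ₗ[F] V} {v : V} (hg : g ∈ unitaryIsometryGroup β)
    (hgv : g ∈ vectorStabilizer v) : g ∈ subspaceStabilizer (LinearMap.ker (β v)) := by
  have hgv' : g v = v := hgv
  refine mem_subspaceStabilizer.2 (Submodule.ext fun x => ?_)
  rw [Submodule.mem_map_equiv, LinearMap.mem_ker, LinearMap.mem_ker, ← hg, hgv',
    LinearEquiv.apply_symm_apply]

/-- An isometry of `v^⊥` extends to an isometry of `V` fixing `v`. -/
theorem exists_extension_of_isometry_ker [FiniteDimensional F V] (hβ : β.IsSymm)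
    (hβ' : β.Nondegenerate) {v : V} (hv : β v v ≠ 0)
    {g : LinearMap.ker (β v) ≃ₗ[F] LinearMap.ker (β v)}
    (hg : g ∈ unitaryIsometryGroup
      (β.domRestrict₁₂ (LinearMap.ker (β v)) (LinearMap.ker (β v)))) :
    ∃ k ∈ unitaryIsometryGroup β ⊓ vectorStabilizer v,
      ∀ x : LinearMap.ker (β v), k x = (g x : LinearMap.ker (β v)) := by
  let π : V →ₗ[F] LinearMap.ker (β v) :=
    (LinearMap.id - ((β v v)⁻¹ • β v).smulRight v).codRestrict _ fun y => by
      have h1 := apply_sub_smul_eq_zero hv y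
      rw [div_eq_inv_mul] at h1
      exact h1
  have hπ : ∀ y, ((π y : LinearMap.ker (β v)) : V) = y - (β v y / β v v) • v := fun y => by
    rw [div_eq_inv_mul]
    rfl
  have hπx : ∀ x : LinearMap.ker (β v), π x = x := fun x => Subtype.ext <| by
    rw [hπ, LinearMap.mem_ker.1 x.2, zero_div, zero_smul, sub_zero]
  let k₀ : V →ₗ[F] V := ((β v v)⁻¹ • β v).smulRight v +
    (LinearMap.ker (β v)).subtype ∘ₗ (g : _ →ₗ[F] LinearMap.ker (β v)) ∘ₗ π
  have hk : ∀ y, k₀ y = (β v y / β v v) • v + (g (π y) : LinearMap.ker (β v)) := fun y => by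
    rw [div_eq_inv_mul]
    rfl
  have h0 : ∀ x : LinearMap.ker (β v), β v x = 0 := fun x => x.2
  have h0' : ∀ x : LinearMap.ker (β v), β x v = 0 := fun x => hβ.eq_iff.1 x.2
  have hdec : ∀ y, y = (β v y / β v v) • v + π y := fun y => by
    rw [hπ]
    abel
  have hiso : ∀ x y, β (k₀ x) (k₀ y) = β x y := fun x y => by
    have h1 : β (g (π x) : LinearMap.ker (β v)) (g (π y) : LinearMap.ker (β v)) =
        β (π x) (π y) := hg (π x) (π y)
    rw [hk, hk]
    conv_rhs => rw [hdec x, hdec y]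
    simp only [map_add, LinearMap.add_apply, map_smul, LinearMap.map_smulₛₗ,
      LinearMap.smul_apply, h0, h0', h1]
  have hinj : Function.Injective k₀ := by
    refine (injective_iff_map_eq_zero k₀).2 fun x hx => hβ'.1 x fun y => ?_
    rw [← hiso, hx, map_zero, LinearMap.zero_apply]
  refine ⟨LinearEquiv.ofInjectiveEndo k₀ hinj, ⟨hiso, ?_⟩, fun x => ?_⟩
  · have hπv : π v = 0 := Subtype.ext <| by
      rw [hπ, div_self hv, one_smul, sub_self]
      rfl
    change k₀ v = v
    rw [hk, hπv, map_zero, div_self hv, one_smul, Submodule.coe_zero, add_zero]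
  · change k₀ x = _
    rw [hk, hπx, h0, zero_div, zero_smul, zero_add]

/-- Restriction to `v^⊥` identifies the stabilizer of a nonisotropic vector `v` with the isometry
group of `v^⊥`. -/
theorem exists_mulEquiv_isometryGroup_ker [FiniteDimensional F V] (hβ : β.IsSymm)
    (hβ' : β.Nondegenerate) {v : V} (hv : β v v ≠ 0) :
    ∃ r : (unitaryIsometryGroup β ⊓ vectorStabilizer v : Subgroup (V ≃ₗ[F] V)) ≃*
        unitaryIsometryGroup
          (β.domRestrict₁₂ (LinearMap.ker (β v)) (LinearMap.ker (β v))),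
      ∀ k (x : LinearMap.ker (β v)),
        (((r k : LinearMap.ker (β v) ≃ₗ[F] LinearMap.ker (β v)) x : LinearMap.ker (β v)) : V)
          = (k : V ≃ₗ[F] V) (x : V) := by
  let r₀ := ((restrictHom (LinearMap.ker (β v))).comp (Subgroup.inclusion
    (fun g (hg : g ∈ unitaryIsometryGroup β ⊓ vectorStabilizer v) =>
      mem_subspaceStabilizer_ker hg.1 hg.2))).codRestrict
    (unitaryIsometryGroup (β.domRestrict₁₂ (LinearMap.ker (β v)) (LinearMap.ker (β v))))
    (fun k x y => k.2.1 x y)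
  have hr₀ : ∀ k (x : LinearMap.ker (β v)),
      (((r₀ k : LinearMap.ker (β v) ≃ₗ[F] LinearMap.ker (β v)) x : LinearMap.ker (β v)) : V)
        = (k : V ≃ₗ[F] V) (x : V) := fun _ _ => rfl
  have hbij : Function.Bijective r₀ := by
    refine ⟨fun k l hkl => Subtype.ext (LinearEquiv.ext fun y => ?_), fun g => ?_⟩
    · have hy : (β v y / β v v) • v + (y - (β v y / β v v) • v) = y := by abel
      have hk : (k : V ≃ₗ[F] V) v = v := k.2.2
      have hl : (l : V ≃ₗ[F] V) v = v := l.2.2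
      have h1 := hr₀ k ⟨_, apply_sub_smul_eq_zero hv y⟩
      rw [hkl, hr₀ l] at h1
      rw [← hy, map_add, map_add, map_smul, map_smul, hk, hl]
      exact congrArg _ h1.symm
    · obtain ⟨k, hk, hkx⟩ := exists_extension_of_isometry_ker hβ hβ' hv g.2
      exact ⟨⟨k, hk⟩, Subtype.ext (LinearEquiv.ext fun x => Subtype.ext (hkx x))⟩
  exact ⟨MulEquiv.ofBijective r₀ hbij, hr₀⟩

end Restriction

/-! ### The largest normal `p`-subgroup of the parabolic subgroup -/

section Core

variable {F V : Type*} [Field F] [AddCommGroup V] [Module F V] {σ : F →+* F}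
  {β : V →ₛₗ[σ] V →ₗ[F] F} {E : Submodule F V}

/-- If the stabilizer `A` of a Lagrangian subspace `E` is transitive on the nonzero vectors of `E`,
then `O_p(A)` is the unipotent radical: a normal `p`-subgroup of `A` fixes some nonzero vector of
`E`, hence all of them. -/
theorem IsLagrangian.parabolicCore_eq (hE : IsLagrangian β E) (p : ℕ) [Fact p.Prime] [CharP F p]
    [Finite E] (hpE : p ∣ Nat.card E)
    (htrans : ∀ x ∈ E, ∀ y ∈ E, x ≠ 0 → y ≠ 0 → ∃ g ∈ parabolicSubgroup β E, g x = y) :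
    parabolicCore p β E = unipotentRadical β E := by
  refine le_antisymm (Subgroup.map_le_iff_le_comap.2 (sSup_le ?_)) fun g hg => ?_
  · rintro N ⟨hN, hNp⟩ g hg
    refine ⟨g.2.1, fun x hx => ?_⟩
    let ρ : N →* (E ≃ₗ[F] E) :=
      (restrictHom E).comp ((Subgroup.inclusion inf_le_right).comp N.subtype)
    have hρ : ∀ (n : N) (x : E), ((ρ n x : E) : V) = ((n : parabolicSubgroup β E) : V ≃ₗ[F] V) x :=
      fun _ _ => rfl
    let _ : MulAction N E := MulAction.compHom E ρ
    have hsmul : ∀ (n : N) (x : E), n • x = ρ n x := fun _ _ => rfl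
    obtain ⟨y, hy, hy0⟩ := hNp.exists_fixed_point_of_prime_dvd_card_of_fixed_point E hpE
      (a := (0 : E)) (fun n => by rw [hsmul, map_zero])
    have hyfix : ∀ n ∈ N, (n : V ≃ₗ[F] V) y = y := fun n hn => by
      have h1 := hy ⟨n, hn⟩
      rw [hsmul] at h1
      rw [← hρ ⟨n, hn⟩, h1]
    by_cases hx0 : x = 0
    · rw [hx0]
      exact map_zero _
    obtain ⟨a, ha, hax⟩ := htrans y y.2 x hx (fun h => hy0 (Subtype.ext h.symm)) hx0
    have h1 := hyfix _ (hN.conj_mem g hg (⟨a, ha⟩ : parabolicSubgroup β E)⁻¹)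
    rw [inv_inv] at h1
    change a.symm ((g : V ≃ₗ[F] V) (a y)) = y at h1
    rw [LinearEquiv.symm_apply_eq, hax] at h1
    exact h1
  · refine ⟨⟨g, unipotentRadical_le_parabolicSubgroup hg⟩, ?_, rfl⟩
    have hle : (unipotentRadical β E).subgroupOf (parabolicSubgroup β E) ≤
        pCore p (parabolicSubgroup β E) := by
      refine le_sSup ⟨⟨fun n hn a => conj_mem_unipotentRadical a.2 hn⟩, fun n => ⟨1, ?_⟩⟩
      rw [pow_one]
      have h1 := (hE.isElementaryAbelian_unipotentRadical p).2 ⟨n, n.2⟩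
      exact Subtype.ext (Subtype.ext (congrArg Subtype.val h1 :))
    exact hle hg

end Core

/-! ### The product of the unipotent radical with a Singer cycle -/

section Structure

variable {F V : Type*} [Field F] [AddCommGroup V] [Module F V] {σ : F →+* F}
  {β : V →ₛₗ[σ] V →ₗ[F] F} {E E' : Submodule F V} {T : Subgroup (E ≃ₗ[F] E)}

theorem restrictPreimage_mono {C D : Subgroup (V ≃ₗ[F] V)} (h : C ≤ D) :
    restrictPreimage C E T ≤ restrictPreimage D E T := fun _ hg => ⟨h hg.1, hg.2⟩

theorem unipotentRadical_le_restrictPreimage :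
    unipotentRadical β E ≤ restrictPreimage (parabolicSubgroup β E) E T := fun _ hg =>
  ⟨unipotentRadical_le_parabolicSubgroup hg, 1, one_mem _, fun x => (hg.2 x x.2).symm⟩

/-- The preimage of `T ≤ GL(E)` in the stabilizer of `E` is the product of the unipotent radical
and of the preimage of `T` in the Levi factor, because the Levi factor induces `GL(E)` on `E`. -/
theorem exists_mul_eq_of_mem_restrictPreimage
    (hlift : ∀ t : E ≃ₗ[F] E, ∃ g ∈ leviFactor β E E', ∀ x : E, ((t x : E) : V) = g x)
    {h : V ≃ₗ[F] V} (hh : h ∈ restrictPreimage (parabolicSubgroup β E) E T) :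
    ∃ r ∈ unipotentRadical β E, ∃ s ∈ restrictPreimage (leviFactor β E E') E T, r * s = h := by
  obtain ⟨hA, t, ht, hth⟩ := hh
  obtain ⟨s, hs, hst⟩ := hlift t
  refine ⟨h * s⁻¹, ⟨mul_mem hA.1 (inv_mem hs.1.1), fun x hx => ?_⟩, s, ⟨hs, t, ht, hst⟩,
    inv_mul_cancel_right h s⟩
  change h (s.symm x) = x
  have h1 : s.symm x ∈ E := apply_mem_of_mem_subspaceStabilizer (inv_mem hs.1.2) hx
  rw [← hth ⟨_, h1⟩, hst]
  exact s.apply_symm_apply x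

theorem unipotentRadical_sup_restrictPreimage
    (hlift : ∀ t : E ≃ₗ[F] E, ∃ g ∈ leviFactor β E E', ∀ x : E, ((t x : E) : V) = g x) :
    unipotentRadical β E ⊔ restrictPreimage (leviFactor β E E') E T =
      restrictPreimage (parabolicSubgroup β E) E T := by
  refine le_antisymm (sup_le unipotentRadical_le_restrictPreimage
    (restrictPreimage_mono inf_le_left)) fun h hh => ?_
  obtain ⟨r, hr, s, hs, rfl⟩ := exists_mul_eq_of_mem_restrictPreimage hlift hh
  exact Subgroup.mul_mem_sup hr hs

theorem IsLagrangian.isSolvable_restrictPreimage (hE : IsLagrangian β E)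
    (hT : ∀ s ∈ T, ∀ t ∈ T, s * t = t * s) :
    Group.IsSolvable (restrictPreimage (parabolicSubgroup β E) E T) := by
  let ρ : restrictPreimage (parabolicSubgroup β E) E T →* T :=
    ((restrictHom E).comp (Subgroup.inclusion
      fun g (hg : g ∈ restrictPreimage (parabolicSubgroup β E) E T) => hg.1.2)).codRestrict T
    fun g => by
      obtain ⟨t, ht, htg⟩ := g.2.2
      have h1 : restrictHom E ⟨g, g.2.1.2⟩ = t :=
        LinearEquiv.ext fun x => Subtype.ext (htg x).symm
      change restrictHom E ⟨g, g.2.1.2⟩ ∈ T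
      rwa [h1]
  have : Group.IsSolvable T :=
    Group.isSolvable_of_comm fun s t => Subtype.ext (hT s s.2 t t.2)
  have : Group.IsSolvable (unipotentRadical β E) :=
    Group.isSolvable_of_comm fun g h => Subtype.ext (hE.unipotentRadical_mul_comm g.2 h.2)
  refine Group.isSolvable_of_ker_le_range
    (Subgroup.inclusion (unipotentRadical_le_restrictPreimage (β := β) (T := T))) ρ fun g hg => ?_
  refine ⟨⟨g, g.2.1.1, fun x hx => ?_⟩, rfl⟩
  have h1 := congrArg (fun t : T => (((t : E ≃ₗ[F] E) ⟨x, hx⟩ : E) : V)) (MonoidHom.mem_ker.1 hg)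
  exact h1

/-- Elements of the preimage of a Singer cycle which fix a nonisotropic vector `v` are unipotent:
if `h` acts on `E` as `t ≠ 1`, then `E` consists of the vectors `h x - x`, and these are
orthogonal to `v = h v`. -/
theorem mem_unipotentRadical_of_apply_eq {F : Type u} {V : Type w} [Field F] [AddCommGroup V]
    [Module F V] {σ : F →+* F} {β : V →ₛₗ[σ] V →ₗ[F] F} {E : Submodule F V}
    {T : Subgroup (E ≃ₗ[F] E)} (hE : IsLagrangian β E)
    (hT : IsSingerCycle T) {v : V} (hv : v ∉ E) {h : V ≃ₗ[F] V}
    (hh : h ∈ restrictPreimage (parabolicSubgroup β E) E T) (hhv : h v = v) :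
    h ∈ unipotentRadical β E := by
  obtain ⟨hA, t, ht, hth⟩ := hh
  refine ⟨hA.1, fun x hx => ?_⟩
  have ht1 : t = 1 := by
    by_contra ht1
    refine hv ((hE v).2 fun y hy => ?_)
    obtain ⟨x, hxy⟩ := hT.exists_apply_sub_eq ht ht1 ⟨y, hy⟩
    have h1 := hA.1 x v
    have h2 : h x - x = y := by
      rw [← hth]
      exact congrArg Subtype.val hxy
    rw [← h2, map_sub, LinearMap.sub_apply, ← h1, hhv, sub_self]
  rw [← hth ⟨x, hx⟩, ht1]
  rfl

/-- The preimage of a Singer cycle is transitive on the vectors of each nonzero norm: the Levi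
factor moves the functional `β v` on `E` to `β u`, and the unipotent radical does the rest. -/
theorem exists_restrictPreimage_apply_eq {F : Type u} {V : Type w} [Field F] [AddCommGroup V]
    [Module F V] [FiniteDimensional F V] {σ : F →+* F} {β : V →ₛₗ[σ] V →ₗ[F] F}
    {E E' : Submodule F V} {T : Subgroup (E ≃ₗ[F] E)} (hE : IsLagrangian β E)
    (hβ : β.IsSymm) (hT : IsSingerCycle T)
    (hlift : ∀ t : E ≃ₗ[F] E, ∃ g ∈ leviFactor β E E', ∀ x : E, ((t x : E) : V) = g x)
    {u v : V} (hu : u ∉ E) (hv : v ∉ E) (huv : β u u = β v v) :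
    ∃ h ∈ restrictPreimage (parabolicSubgroup β E) E T, h v = u := by
  have hne : ∀ z ∉ E, (β z).domRestrict E ≠ 0 := fun z hz h0 => by
    obtain ⟨x, hx, hxz⟩ := hE.exists_apply_eq_one hβ hz
    have h1 : β z x = 0 := LinearMap.congr_fun h0 ⟨x, hx⟩
    rw [← hβ.eq, h1, map_zero] at hxz
    exact zero_ne_one hxz
  obtain ⟨t, ht, htx⟩ := hT.exists_functional_apply_eq (hne u hu) (hne v hv)
  obtain ⟨s, hs, hst⟩ := hlift t
  have hsv : s v - u ∈ E := by
    -- Every vector of `E` has the form `s x` with `x ∈ E`.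
    refine (hE _).2 fun y hy => hβ.eq_iff.1 ?_
    obtain ⟨x, hxy⟩ := t.surjective ⟨y, hy⟩
    have h1 : s x = y := by
      rw [← hst, hxy]
    have h2 : β u (t x : E) = β v x := htx x
    have h3 := hs.1.1 v x
    rw [map_sub, LinearMap.sub_apply, ← h1, h3, ← hst, h2, sub_self]
  have hsvE : s v ∉ E := fun h => hu (by simpa using E.sub_mem h hsv)
  obtain ⟨r, hr, hrv⟩ := hE.exists_unipotentRadical_apply_eq hβ hsvE
    (w := u - s v) (by simpa using E.neg_mem hsv) (by
      rw [add_sub_cancel, huv, hs.1.1])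
  refine ⟨r * s, mul_mem (unipotentRadical_le_restrictPreimage hr)
    (restrictPreimage_mono inf_le_left ⟨hs, t, ht, hst⟩), ?_⟩
  change r (s v) = u
  rw [hrv, add_sub_cancel]

end Structure

section Levi

variable {F V ι : Type*} [Field F] [AddCommGroup V] [Module F V] {σ : F →+* F}
  {β : V →ₛₗ[σ] V →ₗ[F] F} [DecidableEq ι] [Fintype ι] {b : Module.Basis (ι ⊕ ι) F V}

theorem IsWittBasis.unipotentRadical_inf_leviFactor (hb : IsWittBasis β b) (hβ : β.IsSymm) :
    unipotentRadical β (inlSpan b) ⊓ leviFactor β (inlSpan b) (inrSpan b) = ⊥ := by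
  refine (Subgroup.eq_bot_iff_forall _).2 fun g hg => ?_
  refine LinearEquiv.toLinearMap_injective (b.ext ?_)
  rintro (j | j)
  · exact hg.1.2 _ (inl_mem_inlSpan j)
  · exact sub_eq_zero.1 (hb.eq_zero_of_mem_of_mem hβ
      ((hb.isLagrangian hβ).sub_mem hg.1 _)
      (sub_mem (apply_mem_of_mem_subspaceStabilizer hg.2.2 (inr_mem_inrSpan j))
        (inr_mem_inrSpan j)))

/-- Restriction to `E` identifies the preimage of `T ≤ GL(E)` in the Levi factor with `T`. -/
theorem IsWittBasis.nonempty_mulEquiv_restrictPreimage (hb : IsWittBasis β b) (hβ : β.IsSymm)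
    (hβ' : β.Nondegenerate) (T : Subgroup (inlSpan b ≃ₗ[F] inlSpan b)) :
    Nonempty (restrictPreimage (leviFactor β (inlSpan b) (inrSpan b)) (inlSpan b) T ≃* T) := by
  let ρ : restrictPreimage (leviFactor β (inlSpan b) (inrSpan b)) (inlSpan b) T →* T :=
    ((restrictHom (inlSpan b)).comp (Subgroup.inclusion
      fun g (hg : g ∈ restrictPreimage (leviFactor β (inlSpan b) (inrSpan b)) (inlSpan b) T) =>
        hg.1.1.2)).codRestrict T
      fun g => by
        obtain ⟨t, ht, htg⟩ := g.2.2
        have h1 : restrictHom (inlSpan b) ⟨g, g.2.1.1.2⟩ = t :=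
          LinearEquiv.ext fun x => Subtype.ext (htg x).symm
        change restrictHom (inlSpan b) ⟨g, g.2.1.1.2⟩ ∈ T
        rwa [h1]
  refine ⟨MulEquiv.ofBijective ρ ⟨(injective_iff_map_eq_one ρ).2 fun g hg => ?_, fun t => ?_⟩⟩
  · have h1 : ∀ x ∈ inlSpan b, (g : V ≃ₗ[F] V) x = x := fun x hx =>
      congrArg (fun t : T => (((t : inlSpan b ≃ₗ[F] inlSpan b) ⟨x, hx⟩ : inlSpan b) : V)) hg
    have h2 : (g : V ≃ₗ[F] V) ∈
        unipotentRadical β (inlSpan b) ⊓ leviFactor β (inlSpan b) (inrSpan b) :=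
      ⟨⟨g.2.1.1.1, h1⟩, g.2.1⟩
    rw [hb.unipotentRadical_inf_leviFactor hβ, Subgroup.mem_bot] at h2
    exact Subtype.ext h2
  · obtain ⟨g, hg, hgt⟩ := hb.exists_mem_leviFactor hβ hβ' (t : inlSpan b ≃ₗ[F] inlSpan b)
    exact ⟨⟨g, hg, t, t.2, hgt⟩,
      Subtype.ext (LinearEquiv.ext fun x => Subtype.ext (hgt x).symm)⟩

end Levi

theorem proposition5p2
    (p f q m : ℕ) (hp : Fact p.Prime) (hf : 1 ≤ f) (hq : q = p ^ f) (hm : 2 ≤ m)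
    {F V : Type*} [Field F] (hF : Nat.card F = q ^ 2)
    (σ : F →+* F) (hσ : ∀ x, σ x = x ^ q)
    [AddCommGroup V] [Module F V] (hV : Module.finrank F V = 2 * m)
    -- a non-degenerate unitary form
    (β : V →ₛₗ[σ] V →ₗ[F] F) (hβ : β.IsSymm) (hβ' : β.Nondegenerate)
    -- a basis `e₁, …, e_m, f₁, …, f_m` adapted to the form
    (b : Module.Basis (Fin m ⊕ Fin m) F V)
    (hee : ∀ i j, β (b (Sum.inl i)) (b (Sum.inl j)) = 0)
    (hff : ∀ i j, β (b (Sum.inr i)) (b (Sum.inr j)) = 0)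
    (hef : ∀ i j, β (b (Sum.inl i)) (b (Sum.inr j)) = if i = j then 1 else 0)
    -- the subspaces spanned by the `e_i` and by the `f_i`
    (E E' : Submodule F V)
    (hE : E = Submodule.span F (Set.range fun i => b (Sum.inl i)))
    (hE' : E' = Submodule.span F (Set.range fun i => b (Sum.inr i)))
    -- a nonisotropic vector
    (v : V) (hv : β v v ≠ 0)
    -- a Singer cycle of `GL(E)`, and the groups `G, A, C, R, S, H, K`
    (T : Subgroup (E ≃ₗ[F] E)) (hT : IsSingerCycle T)
    (G A C R S H K : Subgroup (V ≃ₗ[F] V))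
    (hG : G = unitaryIsometryGroup β)
    (hA : A = parabolicSubgroup β E)
    (hC : C = leviFactor β E E')
    (hR : R = parabolicCore p β E)
    (hS : S = restrictPreimage C E T)
    (hH : H = R ⊔ S)
    (hK : K = G ⊓ vectorStabilizer v) :
    -- `H = q^{m^2} : GL_1(q^{2m})` is a solvable subgroup of `A`
    H ≤ A ∧ Group.IsSolvable H ∧
    (R.subgroupOf H).Normal ∧ Subgroup.IsComplement' (R.subgroupOf H) (S.subgroupOf H) ∧
    IsElementaryAbelian p R ∧ Nat.card R = q ^ (m ^ 2) ∧
    Nonempty (S ≃* Matrix.GeneralLinearGroup (Fin 1) (GaloisField p (2 * f * m))) ∧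
    -- `H ∩ K = R ∩ K = q^{(m-1)^2}`
    H ⊓ K = R ⊓ K ∧
    IsElementaryAbelian p (R ⊓ K : Subgroup (V ≃ₗ[F] V)) ∧
    Nat.card (R ⊓ K : Subgroup (V ≃ₗ[F] V)) = q ^ ((m - 1) ^ 2) ∧
    -- `K = GU_{2m-1}(q)`: restriction identifies `K` with the isometry group of the
    -- non-degenerate space `v^⊥` of dimension `2m - 1`
    Module.finrank F (LinearMap.ker (β v)) = 2 * m - 1 ∧
    (β.domRestrict₁₂ (LinearMap.ker (β v)) (LinearMap.ker (β v))).Nondegenerate ∧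
    (∃ r : K ≃* unitaryIsometryGroup
        (β.domRestrict₁₂ (LinearMap.ker (β v)) (LinearMap.ker (β v))),
      ∀ (k : K) (x : LinearMap.ker (β v)),
        (((r k : LinearMap.ker (β v) ≃ₗ[F] LinearMap.ker (β v)) x : LinearMap.ker (β v)) : V)
          = (k : V ≃ₗ[F] V) (x : V)) ∧
    -- `G = HK`
    (H : Set (V ≃ₗ[F] V)) * (K : Set (V ≃ₗ[F] V)) = (G : Set (V ≃ₗ[F] V)) := by
  have hq1 : 1 < q := hq ▸ Nat.one_lt_pow (by omega) hp.out.one_lt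
  have : Finite F := Nat.finite_of_card_ne_zero (by rw [hF]; positivity)
  have := Fintype.ofFinite F
  have hchar : CharP F p := charP_of_card_eq_prime_pow (f := f * 2) (by
    rw [← Nat.card_eq_fintype_card, hF, hq, pow_mul])
  have hσσ : ∀ a, σ (σ a) = a := fun a => by
    rw [hσ, hσ, ← pow_mul, ← sq, ← hF, Nat.card_eq_fintype_card, FiniteField.pow_card]
  obtain ⟨d, hd⟩ := exists_pow_ne_of_card_eq_sq hq1 hF
  rw [← hσ] at hd
  have : FiniteDimensional F V := b.finiteDimensional_of_finite
  have hb : IsWittBasis β b := ⟨hee, hff, hef⟩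
  obtain rfl : E = inlSpan b := hE
  obtain rfl : E' = inrSpan b := hE'
  have hL := hb.isLagrangian hβ
  have hlift := hb.exists_mem_leviFactor hβ hβ'
  have hnotmem : ∀ u, β u u ≠ 0 → u ∉ inlSpan b := fun u hu h => hu ((hL u).1 h u h)
  have hEcard : Nat.card (inlSpan b) = q ^ (2 * m) := by
    have h1 : Module.finrank F (inlSpan b) = m := by
      have h2 := finrank_span_eq_card (b.linearIndependent.comp _ Sum.inl_injective)
      rw [Fintype.card_fin] at h2
      exact h2
    rw [Module.natCard_eq_pow_finrank (K := F), hF, h1, ← pow_mul]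
  have : Finite (inlSpan b) := Nat.finite_of_card_ne_zero (by rw [hEcard]; positivity)
  obtain rfl : R = unipotentRadical β (inlSpan b) := by
    rw [hR]
    refine hL.parabolicCore_eq p ?_ fun x hx y hy hx0 hy0 => ?_
    · rw [hEcard, hq]
      exact dvd_pow (dvd_pow_self p (by omega)) (by omega)
    · obtain ⟨t, -, htx⟩ := hT.exists_apply_eq (x := ⟨x, hx⟩) (y := ⟨y, hy⟩)
        (fun h => hx0 (congrArg Subtype.val h)) (fun h => hy0 (congrArg Subtype.val h))
      obtain ⟨g, hg, hgt⟩ := hlift t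
      exact ⟨g, hg.1, by rw [← hgt ⟨x, hx⟩, htx]⟩
  subst hG hA hC hS hK
  obtain rfl : H = restrictPreimage (parabolicSubgroup β (inlSpan b)) (inlSpan b) T :=
    hH.trans (unipotentRadical_sup_restrictPreimage hlift)
  have hRel := hL.isElementaryAbelian_unipotentRadical p
  have hRcard : Nat.card (unipotentRadical β (inlSpan b)) = q ^ (m ^ 2) := by
    have h1 := hb.card_unipotentRadical_sq hβ hσσ hd
    rw [hF, Fintype.card_fin, pow_right_comm] at h1
    exact Nat.pow_left_injective two_ne_zero h1
  refine ⟨fun g hg => hg.1, hL.isSolvable_restrictPreimage fun s hs t ht => hT.mul_comm hs ht,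
    ⟨fun r hr h => conj_mem_unipotentRadical h.2.1 hr⟩, ?_, hRel, hRcard, ?_, ?_,
    hRel.of_le inf_le_left, ?_, ?_, nondegenerate_domRestrict_ker hβ hβ' hv,
    exists_mulEquiv_isometryGroup_ker hβ hβ' hv, ?_⟩
  · refine Subgroup.isComplement'_of_disjoint_and_mul_eq_univ ?_ ?_
    · refine Subgroup.disjoint_def.2 fun {g} hr hs => Subtype.ext ?_
      exact (Subgroup.eq_bot_iff_forall _).1 (hb.unipotentRadical_inf_leviFactor hβ) g ⟨hr, hs.1⟩
    · refine Set.eq_univ_of_forall fun h => ?_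
      obtain ⟨r, hr, s, hs, hrs⟩ := exists_mul_eq_of_mem_restrictPreimage hlift h.2
      exact ⟨⟨r, unipotentRadical_le_restrictPreimage hr⟩, hr,
        ⟨s, restrictPreimage_mono inf_le_left hs⟩, hs, Subtype.ext hrs⟩
  · obtain ⟨e₁⟩ := hb.nonempty_mulEquiv_restrictPreimage hβ hβ' T
    obtain ⟨e₂⟩ := hT.nonempty_mulEquiv (p := p) (n := 2 * f * m) (by
      rw [hEcard, hq, ← pow_mul]
      congr 1
      ring)
    exact ⟨e₁.trans e₂⟩
  · refine le_antisymm (fun h hh => ⟨?_, hh.2⟩)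
      (inf_le_inf_right _ unipotentRadical_le_restrictPreimage)
    exact mem_unipotentRadical_of_apply_eq hL hT (hnotmem v hv) hh.1 hh.2.2
  · have h1 := hL.card_unipotentRadical_inf_mul hβ hσσ hd (by omega) hF (hnotmem v hv)
    rw [hEcard, hRcard, ← pow_succ'] at h1
    obtain ⟨n, rfl⟩ : ∃ n, m = n + 1 := ⟨m - 1, by omega⟩
    have h2 : (n + 1) ^ 2 + 1 = n ^ 2 + 2 * (n + 1) := by ring
    rw [h2, pow_add] at h1
    exact Nat.eq_of_mul_eq_mul_right (by positivity) h1
  · rw [finrank_ker_apply hv, hV]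
  · refine Set.Subset.antisymm ?_ fun g hg => ?_
    · rintro _ ⟨h, hh, k, hk, rfl⟩
      exact Subgroup.mul_mem _ hh.1.1 hk.1
    · have hgv : β (g v) (g v) = β v v := hg v v
      obtain ⟨h, hh, hhv⟩ := exists_restrictPreimage_apply_eq hL hβ hT hlift
        (hnotmem (g v) (hgv ▸ hv)) (hnotmem v hv) hgv
      refine ⟨h, hh, h⁻¹ * g, ⟨Subgroup.mul_mem _ (Subgroup.inv_mem _ hh.1.1) hg, ?_⟩, mul_inv_cancel_left h g⟩
      change h.symm (g v) = v
      rw [LinearEquiv.symm_apply_eq, hhv]
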